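/- For a real $n\times n$ matrix $A$ let $s_1(A)\ge\dots\ge s_n(A)\ge 0$ be its singular values (the square roots of the eigenvalues of $A^TA$, with multiplicity), and let $\kappa(A)=s_1(A)/\min\{s_i(A): s_i(A)>0\}$ be its condition number, i.e. the ratio of the largest to the smallest non-zero singular value (with the convention $\kappa(0)=0$). For integers $0\le m\le n$ let $\mathcal D(m,n,0)$ be the set of diagonal $n\times n$ matrices with exactly $m$ diagonal entries equal to $0$ and $n-m$ diagonal entries equal to $1$. Let $K$ be a random $n\times n$ matrix whose entries are independent standard Gaussian random variables, and for $r>0$ put $W_1=W_1(r)=\sigma_n K$ with $\sigma_n=\sigma_n(r)=\frac{1}{r\sqrt{8n}}$. Let $\underline\tau_n(r)$ denote the smallest eigenvalue of the symmetric matrix $W_1(r)^T+W_1(r)$. Let $D_1\in\mathcal D(\tilde m,n,0)$ and $D\in\mathcal D(m,n,0)$ be fixed (deterministic) with $m+\tilde m\ge 1$, and let $\nu=m+\tilde m-\frac{m\tilde m}{n}$. Then $1\le\nu\le n$. Moreover, for every real $\theta$ with $4<\theta\le 2\sqrt n$ the following hold. (1) If $r>2+2\nu+\theta$ and $W_1=W_1(r)$,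 then with probability at least $1-2e^{-\theta^2/2}-P[s_1(W_1)\ge 1]$ we have $$\kappa\big((D_1W_1+\mathrm{Id})D\big)\le 2\,\frac{1+1/r}{1-(2+2\nu+\theta)/r}.$$ (2) If $r'>1$, $r>r'+r'\nu+\theta$ and $W_1=W_1(r)$, then with probability at least $1-2e^{-\theta^2/2}-P[\underline\tau_n(r')\le -1]$ we have $$\kappa\big((D_1W_1+\mathrm{Id})D\big)\le 2\,\frac{1+s_1(W_1)}{1-(r'+r'\nu+\theta)/r}.$$ -/

import Mathlib

open MeasureTheory ProbabilityTheory

namespace ReLUCond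

noncomputable section

/-- The `i`-th singular value of the real square matrix `A`, in decreasing order and with
multiplicity, counted from `0` (so that `sv A 0` is the largest one); it is the square root of the
corresponding eigenvalue of `Aᵀ A`, and `0` for `n ≤ i`. -/
def sv {n : ℕ} (A : Matrix (Fin n) (Fin n) ℝ) (i : ℕ) : ℝ :=
  (Matrix.toEuclideanLin A).singularValues i

/-- The largest singular value. -/
def s1 {n : ℕ} (A : Matrix (Fin n) (Fin n) ℝ) : ℝ := sv A 0

/-- The smallest non-zero singular value (a minimum over a finite set, non-empty for `A ≠ 0`). -/
def sStar {n : ℕ} (A : Matrix (Fin n) (Fin n) ℝ) : ℝ :=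
  sInf {s : ℝ | 0 < s ∧ ∃ i : Fin n, sv A i = s}

/-- The condition number: the ratio of the largest to the smallest non-zero singular value.
The zero matrix has no non-zero singular value; for it the value is `0 / 0 = 0`. -/
def cond {n : ℕ} (A : Matrix (Fin n) (Fin n) ℝ) : ℝ := s1 A / sStar A

/-- The set of diagonal `n × n` matrices with `m` diagonal entries equal to `η` and the other
`n - m` entries equal to `1`. -/
def maskSet (m n : ℕ) (η : ℝ) : Set (Matrix (Fin n) (Fin n) ℝ) :=
  {D | m ≤ n ∧ ∃ l : Fin n → ℝ, D = Matrix.diagonal l ∧ (∀ i, l i = η ∨ l i = 1) ∧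
    D.trace = m * η + n - m}

theorem isHermitian_transpose_add {n : ℕ} (M : Matrix (Fin n) (Fin n) ℝ) :
    (M.transpose + M).IsHermitian := by
  rw [Matrix.IsHermitian, Matrix.conjTranspose_eq_transpose_of_trivial, Matrix.transpose_add,
    Matrix.transpose_transpose, add_comm]

/-- The smallest eigenvalue of the symmetric matrix `Mᵀ + M`. -/
def tauMin {n : ℕ} (M : Matrix (Fin n) (Fin n) ℝ) : ℝ :=
  ⨅ i, (isHermitian_transpose_add M).eigenvalues i

/-- The standard deviation `1 / (r √(8 n))`. -/
def sigma (n : ℕ) (r : ℝ) : ℝ := 1 / (r * √(8 * n))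

/-- The parameter `m + m' - m m' / n`. -/
def nu (m m' n : ℕ) : ℝ := m + m' - m * m' / n

/-- `K` is a random `n × n` matrix with independent standard Gaussian entries. -/
structure IsStdGaussianMatrix {Ω : Type*} [MeasurableSpace Ω] (P : Measure Ω) {n : ℕ}
    (K : Ω → Matrix (Fin n) (Fin n) ℝ) : Prop where
  indep : iIndepFun (fun (p : Fin n × Fin n) (ω : Ω) => K ω p.1 p.2) P
  law : ∀ i j : Fin n, HasLaw (fun ω => K ω i j) (gaussianReal 0 1) P

end

end ReLUCond

namespace ReLUCond

/-! The constants leave enough room for the operator norm alone to decide both parts. Since `ν ≥ 1`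
and `θ > 4`, both `2 + 2ν + θ` and `r' + r'ν + θ` exceed 6, so it suffices that `‖W‖ ≤ 6 / r`, i.e.
`s1 K ≤ 6 √(8n)`. This fails with probability at most `exp (-2n) ≤ exp (-θ² / 2)`, because `θ ≤ 2
√n` (`measureReal_le_s1`); the other subtracted probabilities are simply dropped. On the good event
`D₁ W + 1` is bounded below by `1 - 6 / r`, and the projection `D` on the right does not spoil this
for non-zero singular values (`cond_mul_le`). -/

/-! ### Singular values, operator norm and condition number. -/

theorem toEuclideanLin_mul_apply {n : ℕ} (M N : Matrix (Fin n) (Fin n) ℝ)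
    (x : EuclideanSpace ℝ (Fin n)) :
    Matrix.toEuclideanLin (M * N) x = Matrix.toEuclideanLin M (Matrix.toEuclideanLin N x) := by
  simp [Matrix.toLpLin_apply, Matrix.mulVec_mulVec]

theorem ofLp_toEuclideanLin_apply {n : ℕ} (M : Matrix (Fin n) (Fin n) ℝ)
    (x : EuclideanSpace ℝ (Fin n)) (i : Fin n) :
    Matrix.toEuclideanLin M x i = M.mulVec x i := by
  simp [Matrix.toLpLin_apply]

open Matrix in
theorem exists_norm_eq_one_of_sv_pos {n : ℕ} (A : Matrix (Fin n) (Fin n) ℝ) {i : ℕ}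
    (hi : 0 < sv A i) :
    ∃ v : EuclideanSpace ℝ (Fin n), ‖v‖ = 1 ∧ ‖toEuclideanLin A v‖ = sv A i ∧
      toEuclideanLin (Aᵀ * A) v = sv A i ^ 2 • v := by
  have hin : i < Module.finrank ℝ (EuclideanSpace ℝ (Fin n)) := by
    by_contra! h
    exact hi.ne' ((toEuclideanLin A).singularValues_of_finrank_le h)
  have hT := (toEuclideanLin A).isSymmetric_adjoint_comp_self
  have hv1 : ‖hT.eigenvectorBasis rfl ⟨i, hin⟩‖ = 1 :=
    (hT.eigenvectorBasis rfl).orthonormal.1 _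
  have hev := hT.apply_eigenvectorBasis rfl ⟨i, hin⟩
  rw [← (toEuclideanLin A).sq_singularValues_fin rfl ⟨i, hin⟩] at hev
  set v := hT.eigenvectorBasis rfl ⟨i, hin⟩
  refine ⟨v, hv1, ?_, ?_⟩
  · have h := congrArg (fun w => inner ℝ w v) hev
    simp only [LinearMap.comp_apply, LinearMap.adjoint_inner_left, real_inner_self_eq_norm_sq,
      RCLike.ofReal_real_eq_id, id_eq, inner_smul_left, hv1] at h
    exact (sq_eq_sq₀ (norm_nonneg _) hi.le).1 (by simpa [sv] using h)
  · rw [← Matrix.conjTranspose_eq_transpose_of_trivial]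
    rw [toEuclideanLin_mul_apply, toEuclideanLin_conjTranspose_eq_adjoint]
    exact hev

theorem s1_nonneg {n : ℕ} (A : Matrix (Fin n) (Fin n) ℝ) : 0 ≤ s1 A :=
  LinearMap.singularValues_nonneg _ _

theorem s1_le_of_norm_le {n : ℕ} {A : Matrix (Fin n) (Fin n) ℝ} {C : ℝ} (hC : 0 ≤ C)
    (h : ∀ x, ‖Matrix.toEuclideanLin A x‖ ≤ C * ‖x‖) : s1 A ≤ C := by
  rcases (s1_nonneg A).eq_or_lt with h0 | h0
  · rwa [← h0]
  · obtain ⟨v, hv, hA, -⟩ := exists_norm_eq_one_of_sv_pos A h0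
    have := h v
    rw [hA, hv, mul_one] at this
    exact this

theorem norm_toEuclideanLin_le {n : ℕ} (A : Matrix (Fin n) (Fin n) ℝ)
    (x : EuclideanSpace ℝ (Fin n)) : ‖Matrix.toEuclideanLin A x‖ ≤ s1 A * ‖x‖ := by
  set T := Matrix.toEuclideanLin A
  have hT := T.isSymmetric_adjoint_comp_self
  set b := hT.eigenvectorBasis rfl
  refine le_of_sq_le_sq ?_ (mul_nonneg (s1_nonneg A) (norm_nonneg x))
  calc ‖T x‖ ^ 2 = inner ℝ x ((LinearMap.adjoint T ∘ₗ T) x) := by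
        rw [LinearMap.comp_apply, LinearMap.adjoint_inner_right, real_inner_self_eq_norm_sq]
    _ = ∑ i, inner ℝ x (b i) * inner ℝ (b i) ((LinearMap.adjoint T ∘ₗ T) x) :=
        (b.sum_inner_mul_inner _ _).symm
    _ = ∑ i : Fin _, T.singularValues (i : ℕ) ^ 2 * (inner ℝ x (b i) * inner ℝ (b i) x) := by
        refine Finset.sum_congr rfl fun i _ => ?_
        rw [← hT, hT.apply_eigenvectorBasis rfl i, ← T.sq_singularValues_fin rfl i]
        simp only [RCLike.ofReal_real_eq_id, id_eq, inner_smul_left, b]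
        simp only [conj_trivial]
        ring
    _ ≤ ∑ i : Fin _, s1 A ^ 2 * (inner ℝ x (b i) * inner ℝ (b i) x) := by
        refine Finset.sum_le_sum fun i _ => ?_
        refine mul_le_mul_of_nonneg_right ?_ ?_
        · exact pow_le_pow_left₀ (T.singularValues_nonneg _)
            (T.singularValues_antitone (Nat.zero_le _)) 2
        · rw [real_inner_comm]; exact mul_self_nonneg _
    _ = (s1 A * ‖x‖) ^ 2 := by
        rw [← Finset.mul_sum, b.sum_inner_mul_inner, real_inner_self_eq_norm_sq, mul_pow]

open Matrix in
-- A right singular vector `v` of `B D` with non-zero singular value lies in the range of the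
-- projection `D`, so that singular value is `‖B v‖ ≥ c`.
theorem cond_mul_le {n : ℕ} {B D : Matrix (Fin n) (Fin n) ℝ} (hDt : Dᵀ = D) (hDD : D * D = D)
    {c : ℝ} (hc : 0 < c) (h : ∀ x, c * ‖x‖ ≤ ‖toEuclideanLin B x‖) :
    cond (B * D) ≤ s1 (B * D) / c := by
  rcases (s1_nonneg (B * D)).eq_or_lt with h0 | h0
  · simp [cond, ← h0]
  -- Positivity of `n` makes the set in `sStar` non-empty; `sInf ∅ = 0` would give no lower bound.
  · have hn : 0 < n := by
      by_contra! hn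
      exact h0.ne' (LinearMap.singularValues_of_finrank_le _ (by simpa using hn))
    refine div_le_div_of_nonneg_left h0.le hc ?_
    refine le_csInf ⟨s1 (B * D), h0, ⟨0, hn⟩, rfl⟩ ?_
    rintro s ⟨hs, i, rfl⟩
    obtain ⟨v, hv, hA, hE⟩ := exists_norm_eq_one_of_sv_pos _ hs
    have hDv : toEuclideanLin D v = v := by
      have h2 : D * ((B * D)ᵀ * (B * D)) = (B * D)ᵀ * (B * D) := by
        rw [transpose_mul, hDt]
        simp only [← mul_assoc, hDD]
      have h3 := toEuclideanLin_mul_apply D ((B * D)ᵀ * (B * D)) v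
      rw [h2, hE, map_smul] at h3
      exact (smul_right_injective _ (pow_ne_zero 2 hs.ne') h3).symm
    rw [← hA, toEuclideanLin_mul_apply, hDv]
    simpa [hv] using h v

/-! ### Masks as orthogonal projections, and the deterministic bound. -/

theorem transpose_of_mem_maskSet {m n : ℕ} {η : ℝ} {D : Matrix (Fin n) (Fin n) ℝ}
    (hD : D ∈ maskSet m n η) : D.transpose = D := by
  obtain ⟨-, l, rfl, -⟩ := hD
  exact Matrix.diagonal_transpose l

theorem mul_self_of_mem_maskSet {m n : ℕ} {D : Matrix (Fin n) (Fin n) ℝ}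
    (hD : D ∈ maskSet m n 0) : D * D = D := by
  obtain ⟨-, l, rfl, hl, -⟩ := hD
  rw [Matrix.diagonal_mul_diagonal]
  congr 1
  ext i
  rcases hl i with h | h <;> simp [h]

theorem norm_le_of_mem_maskSet {m n : ℕ} {D : Matrix (Fin n) (Fin n) ℝ}
    (hD : D ∈ maskSet m n 0) (x : EuclideanSpace ℝ (Fin n)) :
    ‖Matrix.toEuclideanLin D x‖ ≤ ‖x‖ := by
  obtain ⟨-, l, rfl, hl, -⟩ := hD
  rw [EuclideanSpace.norm_eq, EuclideanSpace.norm_eq]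
  refine Real.sqrt_le_sqrt (Finset.sum_le_sum fun i _ => ?_)
  rw [ofLp_toEuclideanLin_apply, Matrix.mulVec_diagonal]
  rcases hl i with h | h <;> simp [h, sq_nonneg]

/-- Two bounds on the same norm are kept apart: `p` feeds the numerator (`s1 W` in the second part),
`q` the denominator. -/
theorem cond_residual_le {n m m' : ℕ} {D₁ D W : Matrix (Fin n) (Fin n) ℝ}
    (hD₁ : D₁ ∈ maskSet m' n 0) (hD : D ∈ maskSet m n 0) {p q : ℝ} (hp : 0 ≤ p) (hq : q < 1)
    (hWp : ∀ x, ‖Matrix.toEuclideanLin W x‖ ≤ p * ‖x‖)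
    (hWq : ∀ x, ‖Matrix.toEuclideanLin W x‖ ≤ q * ‖x‖) :
    cond ((D₁ * W + 1) * D) ≤ (1 + p) / (1 - q) := by
  have happ : ∀ x, Matrix.toEuclideanLin (D₁ * W + 1) x =
      Matrix.toEuclideanLin D₁ (Matrix.toEuclideanLin W x) + x := by
    intro x
    rw [map_add, LinearMap.add_apply, toEuclideanLin_mul_apply]
    simp
  have hle : ∀ x, ‖Matrix.toEuclideanLin D₁ (Matrix.toEuclideanLin W x)‖ ≤
      ‖Matrix.toEuclideanLin W x‖ := fun x => norm_le_of_mem_maskSet hD₁ _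
  refine (cond_mul_le (transpose_of_mem_maskSet hD) (mul_self_of_mem_maskSet hD)
    (sub_pos.2 hq) fun x => ?_).trans ?_
  · rw [happ]
    have := norm_sub_norm_le x (-(Matrix.toEuclideanLin D₁ (Matrix.toEuclideanLin W x)))
    rw [norm_neg, sub_neg_eq_add, add_comm x] at this
    linarith [hle x, hWq x]
  · refine div_le_div_of_nonneg_right (s1_le_of_norm_le (by linarith) fun x => ?_)
      (sub_pos.2 hq).le
    rw [toEuclideanLin_mul_apply, happ]
    refine (norm_add_le _ _).trans ?_
    have h1 := hle (Matrix.toEuclideanLin D x)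
    have h2 := hWp (Matrix.toEuclideanLin D x)
    have h3 := norm_le_of_mem_maskSet hD x
    nlinarith [mul_le_mul_of_nonneg_left h3 hp]

/-! ### Bounds on `ν`. -/

theorem one_le_nu {m m' n : ℕ} (hm : m ≤ n) (hm' : m' ≤ n) (h : 1 ≤ m + m') :
    1 ≤ nu m m' n := by
  have hn : (0 : ℝ) < n := by exact_mod_cast (by omega : 0 < n)
  have h1 : (m : ℝ) ≤ n := by exact_mod_cast hm
  have h2 : (m' : ℝ) ≤ n := by exact_mod_cast hm'
  rw [nu, le_sub_iff_add_le, ← le_sub_iff_add_le', div_le_iff₀ hn]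
  rcases Nat.eq_zero_or_pos m with rfl | h0
  · have h3 : (1 : ℝ) ≤ m' := by exact_mod_cast (by omega : 1 ≤ m')
    push_cast
    nlinarith
  · have h3 : (1 : ℝ) ≤ m := by exact_mod_cast h0
    nlinarith [mul_nonneg (sub_nonneg.2 h3) (sub_nonneg.2 h2), Nat.cast_nonneg (α := ℝ) m']

theorem nu_le {m m' n : ℕ} (hm : m ≤ n) (hm' : m' ≤ n) (hn : 0 < n) : nu m m' n ≤ n := by
  have hn : (0 : ℝ) < n := by exact_mod_cast hn
  have h1 : (m : ℝ) ≤ n := by exact_mod_cast hm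
  have h2 : (m' : ℝ) ≤ n := by exact_mod_cast hm'
  rw [nu, sub_le_comm, le_div_iff₀ hn]
  -- `n (n - ν) = (n - m) (n - m')`.
  nlinarith [mul_nonneg (sub_nonneg.2 h1) (sub_nonneg.2 h2)]

/-! ### Gaussian tail of the largest singular value. -/

open Matrix

theorem IsStdGaussianMatrix.lintegral_exp_inner {Ω : Type*} [MeasurableSpace Ω] {P : Measure Ω}
    {n : ℕ} {K : Ω → Matrix (Fin n) (Fin n) ℝ} (hK : IsStdGaussianMatrix P K)
    (x y : EuclideanSpace ℝ (Fin n)) (t : ℝ) :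
    ∫⁻ ω, ENNReal.ofReal (Real.exp (t * inner ℝ y (toEuclideanLin (K ω) x))) ∂P =
      ENNReal.ofReal (Real.exp (t ^ 2 * (‖y‖ * ‖x‖) ^ 2 / 2)) := by
  have hmeas : ∀ p : Fin n × Fin n, AEMeasurable (fun ω => K ω p.1 p.2) P :=
    fun p => (hK.law p.1 p.2).aemeasurable
  have hmgf : ∀ (p : Fin n × Fin n) (s : ℝ),
      mgf (fun ω => K ω p.1 p.2) P s = Real.exp (s ^ 2 / 2) := by
    intro p s
    rw [mgf_gaussianReal (hK.law p.1 p.2).map_eq]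
    simp
  have hind : iIndepFun (fun (p : Fin n × Fin n) ω => (y p.1 * x p.2) * K ω p.1 p.2) P :=
    hK.indep.comp (fun p s => (y p.1 * x p.2) * s) fun p => measurable_const_mul _
  have hm' : ∀ p : Fin n × Fin n, AEMeasurable (fun ω => (y p.1 * x p.2) * K ω p.1 p.2) P :=
    fun p => (hmeas p).const_mul _
  have hsum : ∀ ω, inner ℝ y (toEuclideanLin (K ω) x) =
      (∑ p : Fin n × Fin n, fun ω => (y p.1 * x p.2) * K ω p.1 p.2) ω := by
    intro ω
    rw [Finset.sum_apply, Fintype.sum_prod_type, PiLp.inner_apply]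
    refine Finset.sum_congr rfl fun i _ => ?_
    simp only [ofLp_toEuclideanLin_apply, mulVec, dotProduct, RCLike.inner_apply, conj_trivial,
      Finset.sum_mul]
    exact Finset.sum_congr rfl fun j _ => by ring
  have hval : mgf (∑ p : Fin n × Fin n, fun ω => (y p.1 * x p.2) * K ω p.1 p.2) P t =
      Real.exp (t ^ 2 * (‖y‖ * ‖x‖) ^ 2 / 2) := by
    rw [hind.mgf_sum₀ hm']
    simp_rw [mgf_const_mul, hmgf]
    rw [← Real.exp_sum, ← Finset.sum_div, mul_pow, EuclideanSpace.real_norm_sq_eq,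
      EuclideanSpace.real_norm_sq_eq, Finset.sum_mul_sum, Finset.mul_sum, Fintype.sum_prod_type]
    simp_rw [Finset.mul_sum]
    congr 2
    exact Finset.sum_congr rfl fun i _ => Finset.sum_congr rfl fun j _ => by ring
  simp_rw [hsum]
  rw [← hval, mgf, ofReal_integral_eq_lintegral_ofReal]
  -- A non-integrable function has Bochner integral 0, so the positive value of the mgf yields
  -- integrability.
  · refine Integrable.of_integral_ne_zero ?_
    have := hval
    rw [mgf] at this
    rw [this]
    exact (Real.exp_pos _).ne'
  · exact Filter.Eventually.of_forall fun _ => (Real.exp_pos _).le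

/-- Averaging over the unit balls, with the vectors near a maximising pair contributing. -/
theorem ofReal_exp_le_lintegral_ball {n : ℕ} (A : Matrix (Fin n) (Fin n) ℝ) {s t : ℝ} (ht : 0 ≤ t)
    (hs : 0 < s) (hA : s ≤ s1 A) :
    ENNReal.ofReal (Real.exp (t * (s / 2)) * (1 / 64) ^ n) *
        (volume (Metric.ball (0 : EuclideanSpace ℝ (Fin n)) 1) *
          volume (Metric.ball (0 : EuclideanSpace ℝ (Fin n)) 1)) ≤
      ∫⁻ z in (Metric.ball (0 : EuclideanSpace ℝ (Fin n)) 1) ×ˢ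
          (Metric.ball (0 : EuclideanSpace ℝ (Fin n)) 1),
        ENNReal.ofReal (Real.exp (t * inner ℝ z.2 (toEuclideanLin A z.1))) := by
  have hs1 : 0 < sv A 0 := hs.trans_le hA
  obtain ⟨v, hv, hAv, -⟩ := exists_norm_eq_one_of_sv_pos A hs1
  obtain ⟨u, hu, hAu⟩ : ∃ u : EuclideanSpace ℝ (Fin n), ‖u‖ = 1 ∧
      inner ℝ u (toEuclideanLin A v) = s1 A := by
    refine ⟨(s1 A)⁻¹ • toEuclideanLin A v, ?_, ?_⟩
    · rw [norm_smul, hAv, Real.norm_eq_abs, abs_inv, abs_of_nonneg (s1_nonneg A)]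
      exact inv_mul_cancel₀ hs1.ne'
    · rw [inner_smul_left, real_inner_self_eq_norm_sq, hAv, conj_trivial]
      have : s1 A ≠ 0 := hs1.ne'
      change (s1 A)⁻¹ * s1 A ^ 2 = s1 A
      field_simp
  -- Centres at `7/8` keep the balls of radius `1/8` inside the unit ball; on them the form is at
  -- least `(49 - 7 - 7 - 1) / 64 > 1/2` times `s1 A`.
  have hsub : ∀ w : EuclideanSpace ℝ (Fin n), ‖w‖ = 1 →
      Metric.ball ((7 / 8 : ℝ) • w) (1 / 8) ⊆ Metric.ball 0 1 := by
    intro w hw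
    refine Metric.ball_subset_ball' ?_
    rw [dist_zero_right, norm_smul, hw]
    norm_num
  have hvol : ∀ w : EuclideanSpace ℝ (Fin n), volume (Metric.ball w (1 / 8)) =
      ENNReal.ofReal ((1 / 8) ^ n) * volume (Metric.ball (0 : EuclideanSpace ℝ (Fin n)) 1) := by
    intro w
    rw [Measure.addHaar_ball_of_pos _ _ (by norm_num), finrank_euclideanSpace_fin]
  have hlow : ∀ z ∈ (Metric.ball ((7 / 8 : ℝ) • v) (1 / 8)) ×ˢ
      (Metric.ball ((7 / 8 : ℝ) • u) (1 / 8)),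
      s / 2 ≤ inner ℝ z.2 (toEuclideanLin A z.1) := by
    rintro ⟨x, y⟩ ⟨hx, hy⟩
    simp only [Metric.mem_ball, dist_eq_norm] at hx hy
    obtain ⟨a, rfl⟩ : ∃ a, x = (7 / 8 : ℝ) • v + a := ⟨x - (7 / 8 : ℝ) • v, by abel⟩
    obtain ⟨b, rfl⟩ : ∃ b, y = (7 / 8 : ℝ) • u + b := ⟨y - (7 / 8 : ℝ) • u, by abel⟩
    simp only [add_sub_cancel_left] at hx hy
    have hbound : ∀ (w z : EuclideanSpace ℝ (Fin n)) (α β : ℝ), ‖w‖ ≤ α → ‖z‖ ≤ β →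
        -(α * β * s1 A) ≤ inner ℝ w (toEuclideanLin A z) := by
      intro w z α β hw hz
      have h1 := abs_real_inner_le_norm w (toEuclideanLin A z)
      have h2 := norm_toEuclideanLin_le A z
      have h3 : ‖toEuclideanLin A z‖ ≤ s1 A * β :=
        h2.trans (mul_le_mul_of_nonneg_left hz (s1_nonneg A))
      have h4 : ‖w‖ * ‖toEuclideanLin A z‖ ≤ α * (s1 A * β) :=
        mul_le_mul hw h3 (norm_nonneg _) ((norm_nonneg _).trans hw)
      have h5 := neg_abs_le (inner ℝ w (toEuclideanLin A z))
      linarith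
    have e1 := hbound u a 1 (1 / 8) hu.le hx.le
    have e2 := hbound b v (1 / 8) 1 hy.le hv.le
    have e3 := hbound b a (1 / 8) (1 / 8) hy.le hx.le
    simp only [map_add, map_smul, inner_add_left, inner_add_right, inner_smul_left,
      inner_smul_right, conj_trivial, hAu]
    linarith
  calc _ = ENNReal.ofReal (Real.exp (t * (s / 2))) *
        (volume (Metric.ball ((7 / 8 : ℝ) • v) (1 / 8)) *
          volume (Metric.ball ((7 / 8 : ℝ) • u) (1 / 8))) := by
        rw [hvol, hvol, show (1 / 64 : ℝ) ^ n = (1 / 8) ^ n * (1 / 8) ^ n by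
          rw [← mul_pow]; norm_num, ENNReal.ofReal_mul (Real.exp_pos _).le,
          ENNReal.ofReal_mul (by positivity)]
        ring
    _ = ∫⁻ _ in (Metric.ball ((7 / 8 : ℝ) • v) (1 / 8)) ×ˢ (Metric.ball ((7 / 8 : ℝ) • u) (1 / 8)),
          ENNReal.ofReal (Real.exp (t * (s / 2))) := by
        rw [setLIntegral_const, Measure.volume_eq_prod, Measure.prod_prod]
    _ ≤ ∫⁻ z in (Metric.ball ((7 / 8 : ℝ) • v) (1 / 8)) ×ˢ
          (Metric.ball ((7 / 8 : ℝ) • u) (1 / 8)),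
          ENNReal.ofReal (Real.exp (t * inner ℝ z.2 (toEuclideanLin A z.1))) := by
        refine setLIntegral_mono' (measurableSet_ball.prod measurableSet_ball) fun z hz => ?_
        exact ENNReal.ofReal_le_ofReal (Real.exp_le_exp.2
          (mul_le_mul_of_nonneg_left (hlow z hz) ht))
    _ ≤ _ := lintegral_mono_set (Set.prod_mono (hsub v hv) (hsub u hu))

/-- Averaging over pairs of balls replaces a net argument: Tonelli and the Gaussian mgf bound the
mean of the average of `exp (t ⟪y, K x⟫)` by `exp (t² / 2)`, and Markov's inequality concludes. The
choice `t = s / 2` is optimal. -/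
theorem IsStdGaussianMatrix.measure_le_s1 {Ω : Type*} [MeasurableSpace Ω] {P : Measure Ω}
    [IsProbabilityMeasure P] {n : ℕ} {K : Ω → Matrix (Fin n) (Fin n) ℝ}
    (hK : IsStdGaussianMatrix P K) {s : ℝ} (hs : 0 < s) :
    P {ω | s ≤ s1 (K ω)} ≤ ENNReal.ofReal (64 ^ n * Real.exp (-(s ^ 2 / 8))) := by
  set V := volume (Metric.ball (0 : EuclideanSpace ℝ (Fin n)) 1)
  set S := (Metric.ball (0 : EuclideanSpace ℝ (Fin n)) 1) ×ˢ
    (Metric.ball (0 : EuclideanSpace ℝ (Fin n)) 1)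
  have hV0 : V * V ≠ 0 :=
    mul_ne_zero (Metric.measure_ball_pos _ _ one_pos).ne' (Metric.measure_ball_pos _ _ one_pos).ne'
  have hVt : V * V ≠ ⊤ := ENNReal.mul_ne_top measure_ball_lt_top.ne measure_ball_lt_top.ne
  set F : Ω → EuclideanSpace ℝ (Fin n) × EuclideanSpace ℝ (Fin n) → ENNReal :=
    fun ω z => ENNReal.ofReal (Real.exp (s / 2 * inner ℝ z.2 (toEuclideanLin (K ω) z.1)))
  have hF : AEMeasurable (Function.uncurry F) (P.prod (volume.restrict S)) := by
    refine ENNReal.measurable_ofReal.comp_aemeasurable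
      (Real.measurable_exp.comp_aemeasurable (AEMeasurable.const_mul ?_ _))
    simp only [PiLp.inner_apply, ofLp_toEuclideanLin_apply, mulVec, dotProduct,
      RCLike.inner_apply, conj_trivial]
    refine Finset.aemeasurable_fun_sum _ fun i _ => AEMeasurable.mul ?_ ?_
    · refine Finset.aemeasurable_fun_sum _ fun j _ => AEMeasurable.mul ?_ ?_
      · exact (hK.law i j).aemeasurable.comp_fst
      · exact Measurable.aemeasurable (by fun_prop)
    · exact Measurable.aemeasurable (by fun_prop)
  have hswap : ∫⁻ ω, (∫⁻ z in S, F ω z) ∂P ≤ ENNReal.ofReal (Real.exp (s ^ 2 / 8)) * (V * V) := by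
    rw [lintegral_lintegral_swap hF]
    calc ∫⁻ z in S, (∫⁻ ω, F ω z ∂P) ≤ ∫⁻ _ in S, ENNReal.ofReal (Real.exp (s ^ 2 / 8)) := by
          refine setLIntegral_mono' (measurableSet_ball.prod measurableSet_ball) ?_
          rintro ⟨x, y⟩ ⟨hx, hy⟩
          simp only [Metric.mem_ball, dist_zero_right] at hx hy
          rw [hK.lintegral_exp_inner x y]
          refine ENNReal.ofReal_le_ofReal (Real.exp_le_exp.2 ?_)
          have : (‖y‖ * ‖x‖) ^ 2 ≤ 1 := pow_le_one₀ (by positivity)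
            (mul_le_one₀ hy.le (norm_nonneg _) hx.le)
          nlinarith [sq_nonneg s]
      _ = _ := by rw [setLIntegral_const, Measure.volume_eq_prod, Measure.prod_prod]
  set ε := ENNReal.ofReal (Real.exp (s / 2 * (s / 2)) * (1 / 64) ^ n)
  have hε : (0 : ℝ) < Real.exp (s / 2 * (s / 2)) * (1 / 64) ^ n := by positivity
  have hmarkov : ε * (V * V) * P {ω | s ≤ s1 (K ω)} ≤
      ENNReal.ofReal (Real.exp (s ^ 2 / 8)) * (V * V) := by
    refine le_trans ?_ ((mul_meas_ge_le_lintegral₀ hF.lintegral_prod_right' (ε * (V * V))).trans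
      hswap)
    -- Only an inclusion into the Markov event is used, so `s1 ∘ K` need not be shown measurable.
    refine mul_le_mul_right (measure_mono fun ω hω => ?_) _
    exact ofReal_exp_le_lintegral_ball (K ω) (by positivity) hs hω
  have h2 : ε * P {ω | s ≤ s1 (K ω)} ≤ ENNReal.ofReal (Real.exp (s ^ 2 / 8)) := by
    rw [mul_right_comm] at hmarkov
    exact (ENNReal.mul_le_mul_iff_left hV0 hVt).1 hmarkov
  have hε0 : ε ≠ 0 := (ENNReal.ofReal_pos.2 hε).ne'
  rw [mul_comm, ← ENNReal.le_div_iff_mul_le (Or.inl hε0) (Or.inl ENNReal.ofReal_ne_top),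
    ← ENNReal.ofReal_div_of_pos hε] at h2
  refine h2.trans (ENNReal.ofReal_le_ofReal (le_of_eq ?_))
  rw [div_eq_iff hε.ne', one_div, inv_pow]
  have h64 : (64 : ℝ) ^ n ≠ 0 := by positivity
  have : Real.exp (s ^ 2 / 8) = Real.exp (-(s ^ 2 / 8)) * Real.exp (s / 2 * (s / 2)) := by
    rw [← Real.exp_add]; ring_nf
  rw [this]
  field_simp

theorem IsStdGaussianMatrix.measureReal_le_s1 {Ω : Type*} [MeasurableSpace Ω] {P : Measure Ω}
    [IsProbabilityMeasure P] {n : ℕ} (hn : 0 < n) {K : Ω → Matrix (Fin n) (Fin n) ℝ}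
    (hK : IsStdGaussianMatrix P K) :
    P.real {ω | 6 * √(8 * n) ≤ s1 (K ω)} ≤ Real.exp (-(2 * n)) := by
  have hn' : (0 : ℝ) < n := by exact_mod_cast hn
  have h := hK.measure_le_s1 (s := 6 * √(8 * n)) (by positivity)
  refine (ENNReal.toReal_le_of_le_ofReal (by positivity) h).trans ?_
  have h64 : (64 : ℝ) ≤ Real.exp 1 ^ 6 := by
    have h2 : (2 : ℝ) ≤ Real.exp 1 := by linarith [Real.add_one_le_exp 1]
    calc (64 : ℝ) = 2 ^ 6 := by norm_num
      _ ≤ _ := pow_le_pow_left₀ (by norm_num) h2 6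
  have h3 : (64 : ℝ) ^ n ≤ Real.exp (6 * n) := by
    refine (pow_le_pow_left₀ (by norm_num) h64 n).trans (le_of_eq ?_)
    rw [← pow_mul, ← Real.exp_nat_mul]
    push_cast
    ring_nf
  refine (mul_le_mul_of_nonneg_right h3 (Real.exp_pos _).le).trans ?_
  -- Here `s² / 8 = 36 n`, so the exponent is `6n - 36n = -30n`.
  rw [← Real.exp_add, Real.exp_le_exp, mul_pow, Real.sq_sqrt (by positivity)]
  nlinarith

/-! ### Rescaling and the good event. -/

theorem norm_sigma_smul_le {n : ℕ} (hn : 0 < n) {K : Matrix (Fin n) (Fin n) ℝ} {r : ℝ} (hr : 0 < r)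
    (hK : s1 K ≤ 6 * √(8 * n)) (x : EuclideanSpace ℝ (Fin n)) :
    ‖Matrix.toEuclideanLin (sigma n r • K) x‖ ≤ 6 / r * ‖x‖ := by
  have hn' : (0 : ℝ) < n := by exact_mod_cast hn
  have hsq : 0 < √(8 * (n : ℝ)) := Real.sqrt_pos.2 (by positivity)
  have hσ : 0 < sigma n r := by unfold sigma; positivity
  rw [map_smul, LinearMap.smul_apply, norm_smul, Real.norm_of_nonneg hσ.le]
  calc sigma n r * ‖Matrix.toEuclideanLin K x‖ ≤ sigma n r * (6 * √(8 * n) * ‖x‖) := by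
        refine mul_le_mul_of_nonneg_left ((norm_toEuclideanLin_le K x).trans ?_) hσ.le
        exact mul_le_mul_of_nonneg_right hK (norm_nonneg _)
    _ = 6 / r * ‖x‖ := by
        unfold sigma
        field_simp

theorem le_measureReal_of_s1_lt {Ω : Type*} [MeasurableSpace Ω] {P : Measure Ω}
    [IsProbabilityMeasure P] {n : ℕ} {K : Ω → Matrix (Fin n) (Fin n) ℝ}
    (hK : IsStdGaussianMatrix P K) {θ : ℝ} (hθ : 4 < θ) (hθn : θ ≤ 2 * √(n : ℝ)) {S : Set Ω}
    (hS : ∀ ω, s1 (K ω) < 6 * √(8 * n) → ω ∈ S) :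
    1 - 2 * Real.exp (-θ ^ 2 / 2) ≤ P.real S := by
  have hn : 0 < n := by
    rcases Nat.eq_zero_or_pos n with rfl | h
    · norm_num at hθn; linarith
    · exact h
  have hunion : P.real Set.univ ≤ P.real S + P.real {ω | 6 * √(8 * n) ≤ s1 (K ω)} := by
    refine (measureReal_mono fun ω _ => ?_).trans (measureReal_union_le _ _)
    rcases lt_or_ge (s1 (K ω)) (6 * √(8 * n)) with h | h
    · exact Or.inl (hS ω h)
    · exact Or.inr h
  rw [probReal_univ] at hunion
  have hexp : Real.exp (-(2 * n)) ≤ Real.exp (-θ ^ 2 / 2) := by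
    rw [Real.exp_le_exp]
    have := pow_le_pow_left₀ (by linarith) hθn 2
    rw [mul_pow, Real.sq_sqrt (Nat.cast_nonneg n)] at this
    linarith
  linarith [hK.measureReal_le_s1 hn, Real.exp_pos (-θ ^ 2 / 2)]

theorem div_one_sub_div_le {p c r : ℝ} (hp : 0 ≤ p) (hc : 6 ≤ c) (hr : c < r) :
    (1 + p) / (1 - 6 / r) ≤ (1 + p) / (1 - c / r) := by
  have hr0 : 0 < r := by linarith
  refine div_le_div_of_nonneg_left (by linarith) ?_ ?_
  · rw [sub_pos, div_lt_one hr0]; exact hr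
  · exact sub_le_sub_left (div_le_div_of_nonneg_right hc hr0.le) 1

end ReLUCond

theorem mainTheorem3 {Ω : Type*} [MeasurableSpace Ω] (P : Measure Ω) [IsProbabilityMeasure P]
    (n m m' : ℕ) (hm : 1 ≤ m + m')
    (D₁ D : Matrix (Fin n) (Fin n) ℝ)
    (hD₁ : D₁ ∈ ReLUCond.maskSet m' n 0) (hD : D ∈ ReLUCond.maskSet m n 0)
    (K : Ω → Matrix (Fin n) (Fin n) ℝ) (hK : ReLUCond.IsStdGaussianMatrix P K) :
    (1 ≤ ReLUCond.nu m m' n ∧ ReLUCond.nu m m' n ≤ n) ∧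
    ∀ θ : ℝ, 4 < θ → θ ≤ 2 * √(n : ℝ) →
      (∀ r : ℝ, 2 + 2 * ReLUCond.nu m m' n + θ < r →
        1 - 2 * Real.exp (-θ ^ 2 / 2)
            - P.real {ω | 1 ≤ ReLUCond.s1 (ReLUCond.sigma n r • K ω)} ≤
          P.real {ω | ReLUCond.cond ((D₁ * (ReLUCond.sigma n r • K ω) + 1) * D) ≤
            2 * ((1 + 1 / r) / (1 - (2 + 2 * ReLUCond.nu m m' n + θ) / r))}) ∧
      (∀ r' r : ℝ, 1 < r' → r' + r' * ReLUCond.nu m m' n + θ < r →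
        1 - 2 * Real.exp (-θ ^ 2 / 2)
            - P.real {ω | ReLUCond.tauMin (ReLUCond.sigma n r' • K ω) ≤ -1} ≤
          P.real {ω | ReLUCond.cond ((D₁ * (ReLUCond.sigma n r • K ω) + 1) * D) ≤
            2 * ((1 + ReLUCond.s1 (ReLUCond.sigma n r • K ω)) /
              (1 - (r' + r' * ReLUCond.nu m m' n + θ) / r))}) := by
  have hmn := hD.1
  have hmn' := hD₁.1
  have hn : 0 < n := by omega
  have hν := ReLUCond.one_le_nu hmn hmn' hm
  refine ⟨⟨hν, ReLUCond.nu_le hmn hmn' hn⟩, fun θ hθ hθn => ⟨fun r hr => ?_, fun r' r hr' hr => ?_⟩⟩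
  · refine (sub_le_self _ measureReal_nonneg).trans
      (ReLUCond.le_measureReal_of_s1_lt hK hθ hθn fun ω hω => ?_)
    set c := 2 + 2 * ReLUCond.nu m m' n + θ
    have hc : 6 ≤ c := by linarith
    have hr0 : 0 < r := by linarith
    have hW := ReLUCond.norm_sigma_smul_le hn hr0 hω.le
    have h6 : 6 / r < 1 := by rw [div_lt_one hr0]; linarith
    have hd : 0 < 1 - c / r := by rw [sub_pos, div_lt_one hr0]; exact hr
    refine (ReLUCond.cond_residual_le hD₁ hD (by positivity) h6 hW hW).trans
      ((ReLUCond.div_one_sub_div_le (by positivity) hc hr).trans ?_)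
    -- The factor 2 absorbs the numerator: `1 + 6 / r < 2 ≤ 2 (1 + 1 / r)`.
    rw [← mul_div_assoc]
    refine div_le_div_of_nonneg_right ?_ hd.le
    have : 0 < 1 / r := by positivity
    linarith
  · refine (sub_le_self _ measureReal_nonneg).trans
      (ReLUCond.le_measureReal_of_s1_lt hK hθ hθn fun ω hω => ?_)
    set c := r' + r' * ReLUCond.nu m m' n + θ
    have hc : 6 ≤ c := by nlinarith
    have hr0 : 0 < r := by linarith
    have hW := ReLUCond.norm_sigma_smul_le hn hr0 hω.le
    have h6 : 6 / r < 1 := by rw [div_lt_one hr0]; linarith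
    have hd : 0 < 1 - c / r := by rw [sub_pos, div_lt_one hr0]; exact hr
    have hs := ReLUCond.s1_nonneg (ReLUCond.sigma n r • K ω)
    refine (ReLUCond.cond_residual_le hD₁ hD hs h6
      (ReLUCond.norm_toEuclideanLin_le _) hW).trans
      ((ReLUCond.div_one_sub_div_le hs hc hr).trans ?_)
    exact le_mul_of_one_le_left (div_nonneg (by linarith) hd.le) one_le_two
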